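/- Let $n\ge 2$. Let $\mathrm{Lie}(n+2,n)$ be the class of $(n+2)$-dimensional real solvable Lie algebras $L$ whose derived algebra $L^1=[L,L]$ has dimension $n$; let $\mathrm{Lie}_c(n+2,n)$ be the subclass with $L^1$ abelian, and $\mathrm{Lie}_{c}^{0}(n+2,n)$ the subclass of those $L\in \mathrm{Lie}_c(n+2,n)$ for which $L=\mathrm{span}\{z,y\}\oplus L^1$ (as a vector space) for some $z,y\in L$ with $[z,y]=0$. For commuting $A,B\in\mathrm{Mat}_n(\mathbb R)$ let $L(A,B)=\mathbb R z\oplus\mathbb R y\oplus\mathbb R^n$ be the Lie algebra with $\mathbb R^n$ abelian, $[z,x]=Ax$, $[y,x]=Bx$ for $x\in\mathbb R^n$, and $[z,y]=0$. Two pairs $(A,B)$, $(A',B')$ are similar if $(A',B')=(S^{-1}AS,S^{-1}BS)$ for some $S\in\mathrm{GL}_n(\mathbb R)$, and weakly similar if $(A',B')=\bigl(S^{-1}(\alpha A+\beta B)S,\;S^{-1}(\gamma A+\delta B)S\bigr)$ for some $S\in \mathrm{GL}_n(\mathbb R)$ and $\begin{bmatrix}\alpha&\beta\\ \gamma&\delta\end{bmatrix}\in\mathrm{GL}_2(\mathbb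 R)$. A classification problem $P$ (matrix pairs given by their entries, or Lie algebras given by structure constants) contains a problem $Q$ if there are an injective map $n\mapsto N(n)$ on sizes and, for every $n$, a polynomial map sending the objects of $Q$ of size $n$ to objects of $P$ of size $N(n)$ such that two objects of $Q$ are equivalent if and only if their images are equivalent in $P$. It is wild if it contains the problem of classifying pairs of real square matrices up to similarity. Then: 1. For $n\geq 2$, the algebras in $\mathrm{Lie}_{c}^{0}(n+2,n)$ are, up to isomorphism, exactly the $L(A,B)$ with $A,B\in\mathrm{Mat}_n(\mathbb R)$ commuting and $\operatorname{Im}A+\operatorname{Im}B=\mathbb R^n$; for two such pairs, $L(A,B)\cong L(A',B')$ if and only if $(A,B)$ and $(A',B')$ are weakly similar. In particular, the problem of classifying $\mathrm{Lie}_{c}^{0}(n+2,n)$ (all $n\ge2$) contains the problem of classifying such pairs up to weak similarity. 2. The problem of classifying pairs of commuting real matrices up to weak similarity is wild, and remains wild for the pairs of $n\times n$ matrices, $n\ge2$, with $\operatorname{Im}A+\operatorname{Im}B=\mathbb R^n$. 3. The problem of classifying $\mathrm{Lie}(n+2,n)$ (all $n\ge 2$) up to isomorphism is wild, and so are those of classifying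 $\mathrm{Lie}_c(n+2,n)$ and $\mathrm{Lie}_{c}^{0}(n+2,n)$. 4. The wildness is realized uniformly: there are $d\ge1$ and $d\times d$ matrices $T,U$ over the free associative algebra $\mathbb R\langle x_1,x_2\rangle$ such that, for all $m\ge1$ and $M,N\in\mathrm{Mat}_m(\mathbb R)$, the $dm\times dm$ matrices $T(M,N)$, $U(M,N)$ obtained by substituting $M,N$ for $x_1,x_2$ commute, are linearly independent, satisfy $\operatorname{Im}T(M,N)+\operatorname{Im}U(M,N)=\mathbb R^{dm}$ and $L(T(M,N),U(M,N))\in\mathrm{Lie}_{c}^{0}(dm+2,dm)$; and for all $(M,N)$, $(M',N')$ the following are equivalent: $(M,N)$ and $(M',N')$ are similar; $(T(M,N),U(M,N))$ and $(T(M',N'),U(M',N'))$ are weakly similar; $L(T(M,N),U(M,N))\cong L(T(M',N'),U(M',N'))$. -/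

import Mathlib

noncomputable section

namespace WildLie

open Matrix

/-! ### Classification problems, containment, wildness -/

/-- A classification problem. For every size `n` the objects are the points of a real affine space
(with coordinates indexed by `Coord n`: matrix entries, structure constants) that satisfy `Mem n`,
and `Rel n` says which objects are to be identified. -/
structure ClassificationProblem where
  Coord : ℕ → Type
  Mem : ∀ n, (Coord n → ℝ) → Prop
  Rel : ∀ n, (Coord n → ℝ) → (Coord n → ℝ) → Prop

/-- The problem `P` contains the problem `Q`: the objects of `Q` of each size `n` are sent to
objects of `P` of size `N n` (distinct sizes going to distinct sizes) by a polynomial map that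
preserves and reflects equivalence. -/
def ClassificationProblem.Contains (P Q : ClassificationProblem) : Prop :=
  ∃ N : ℕ → ℕ, Function.Injective N ∧
    ∃ F : ∀ n, P.Coord (N n) → MvPolynomial (Q.Coord n) ℝ, ∀ n,
      (∀ a, Q.Mem n a → P.Mem (N n) (fun i => MvPolynomial.eval a (F n i))) ∧
      ∀ a b, Q.Mem n a → Q.Mem n b →
        (Q.Rel n a b ↔
          P.Rel (N n) (fun i => MvPolynomial.eval a (F n i))
            (fun i => MvPolynomial.eval b (F n i)))

/-! ### Pairs of matrices -/

/-- Pairs of square real matrices with rows and columns indexed by `ι`. -/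
abbrev MatPair (ι : Type) : Type := Matrix ι ι ℝ × Matrix ι ι ℝ

section Pairs

variable {ι : Type} [Fintype ι] [DecidableEq ι]

/-- `P' = S⁻¹ P S` for one invertible `S`. -/
def Similar (P P' : MatPair ι) : Prop :=
  ∃ S : GL ι ℝ,
    P'.1 = (↑S⁻¹ : Matrix ι ι ℝ) * P.1 * (S : Matrix ι ι ℝ) ∧
    P'.2 = (↑S⁻¹ : Matrix ι ι ℝ) * P.2 * (S : Matrix ι ι ℝ)

/-- `(A', B') = S⁻¹ (αA + βB, γA + δB) S` with `S` and `(α, β; γ, δ)` invertible. -/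
def WeaklySimilar (P P' : MatPair ι) : Prop :=
  ∃ (S : GL ι ℝ) (g : GL (Fin 2) ℝ),
    P'.1 = (↑S⁻¹ : Matrix ι ι ℝ) * (g.1 0 0 • P.1 + g.1 0 1 • P.2) * (S : Matrix ι ι ℝ) ∧
    P'.2 = (↑S⁻¹ : Matrix ι ι ℝ) * (g.1 1 0 • P.1 + g.1 1 1 • P.2) * (S : Matrix ι ι ℝ)

/-- `Im A + Im B` is the whole space. -/
def JointlySurjective (P : MatPair ι) : Prop :=
  LinearMap.range P.1.mulVecLin ⊔ LinearMap.range P.2.mulVecLin = ⊤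

end Pairs

/-- The pair of `n × n` matrices with given entries. -/
def pairOfCoord {n : ℕ} (a : Fin 2 × Fin n × Fin n → ℝ) : MatPair (Fin n) :=
  (Matrix.of fun i j => a (0, i, j), Matrix.of fun i j => a (1, i, j))

/-- Pairs of `n × n` matrices, `n ≥ 1`, up to simultaneous similarity. -/
def pairsUpToSimilarity : ClassificationProblem where
  Coord n := Fin 2 × Fin n × Fin n
  Mem n _ := 1 ≤ n
  Rel _ a b := Similar (pairOfCoord a) (pairOfCoord b)

/-- Pairs of commuting `n × n` matrices, `n ≥ 1`, up to weak similarity. -/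
def commutingPairsUpToWeakSimilarity : ClassificationProblem where
  Coord n := Fin 2 × Fin n × Fin n
  Mem n a := 1 ≤ n ∧ Commute (pairOfCoord a).1 (pairOfCoord a).2
  Rel _ a b := WeaklySimilar (pairOfCoord a) (pairOfCoord b)

/-- Pairs `(A, B)` of commuting `n × n` matrices, `n ≥ 2`, with `Im A + Im B = ℝⁿ`,
up to weak similarity. -/
def surjectiveCommutingPairsUpToWeakSimilarity : ClassificationProblem where
  Coord n := Fin 2 × Fin n × Fin n
  Mem n a := 2 ≤ n ∧ Commute (pairOfCoord a).1 (pairOfCoord a).2 ∧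
    JointlySurjective (pairOfCoord a)
  Rel _ a b := WeaklySimilar (pairOfCoord a) (pairOfCoord b)

/-- A problem is wild if it contains the problem of classifying pairs of matrices up to
simultaneous similarity. -/
def ClassificationProblem.IsWild (P : ClassificationProblem) : Prop :=
  P.Contains pairsUpToSimilarity

/-! ### Classes of Lie algebras -/

/-- The derived algebra `[L, L]`. -/
abbrev derivedAlgebra (L : Type) [LieRing L] [LieAlgebra ℝ L] : LieIdeal ℝ L :=
  LieAlgebra.derivedSeries ℝ L 1

/-- `Lie(n+2, n)`, `n ≥ 2`: the real solvable Lie algebras of dimension `n + 2` whose derived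
algebra has dimension `n`. -/
def IsLie (n : ℕ) (L : Type) [LieRing L] [LieAlgebra ℝ L] : Prop :=
  2 ≤ n ∧ LieAlgebra.IsSolvable L ∧ Module.finrank ℝ L = n + 2 ∧
    Module.finrank ℝ (derivedAlgebra L) = n

/-- The members of `Lie(n+2, n)` whose derived algebra is abelian. -/
def IsLieC (n : ℕ) (L : Type) [LieRing L] [LieAlgebra ℝ L] : Prop :=
  IsLie n L ∧ IsLieAbelian (derivedAlgebra L)

/-- The members of `Lie(n+2, n)` whose derived algebra is abelian and is complemented by the span
of two commuting elements `z`, `y`. -/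
def IsLieCZ (n : ℕ) (L : Type) [LieRing L] [LieAlgebra ℝ L] : Prop :=
  IsLieC n L ∧ ∃ z y : L, ⁅z, y⁆ = 0 ∧
    IsCompl (Submodule.span ℝ {z, y}) (derivedAlgebra L).toSubmodule

/-- `c` is the array of structure constants of `L` in some basis. -/
def HasStructureConstants {k : ℕ} (c : Fin k × Fin k × Fin k → ℝ)
    (L : Type) [LieRing L] [LieAlgebra ℝ L] : Prop :=
  ∃ b : Module.Basis (Fin k) ℝ L, ∀ i j, ⁅b i, b j⁆ = ∑ l, c (i, j, l) • b l

/-- The problem of classifying, up to isomorphism, the Lie algebras of a class `C` of Lie algebras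
(with `C n` consisting of Lie algebras of dimension `n + 2`), given by structure constants. -/
def lieProblem (C : ℕ → ∀ (L : Type) [LieRing L] [LieAlgebra ℝ L], Prop) :
    ClassificationProblem where
  Coord n := Fin (n + 2) × Fin (n + 2) × Fin (n + 2)
  Mem n c := ∃ (L : Type) (_ : LieRing L) (_ : LieAlgebra ℝ L), C n L ∧ HasStructureConstants c L
  Rel _ c c' := ∃ (L : Type) (_ : LieRing L) (_ : LieAlgebra ℝ L)
    (L' : Type) (_ : LieRing L') (_ : LieAlgebra ℝ L'),
    HasStructureConstants c L ∧ HasStructureConstants c' L' ∧ Nonempty (L ≃ₗ⁅ℝ⁆ L')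

/-! ### The Lie algebra `ℝ z ⊕ (ℝ y ⊕ ℝⁿ)` of a pair of commuting matrices -/

section Ext

variable {ι : Type} [Fintype ι]

/-- The Lie algebra with underlying space `ℝⁿ ⊕ ℝ z ⊕ ℝ y` (an element `(x, s, t)` is
`x + s z + t y`) in which `ℝⁿ` is abelian, `[z, x] = A x`, `[y, x] = B x` and `[z, y] = 0`. -/
def Ext (A B : Matrix ι ι ℝ) (_ : Commute A B) : Type := (ι → ℝ) × ℝ × ℝ

variable {A B : Matrix ι ι ℝ} {h : Commute A B}

instance : AddCommGroup (Ext A B h) := inferInstanceAs (AddCommGroup ((ι → ℝ) × ℝ × ℝ))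

instance : Module ℝ (Ext A B h) := inferInstanceAs (Module ℝ ((ι → ℝ) × ℝ × ℝ))

instance : Bracket (Ext A B h) (Ext A B h) where
  bracket u v :=
    ((u.2.1 • A *ᵥ v.1 + u.2.2 • B *ᵥ v.1) - (v.2.1 • A *ᵥ u.1 + v.2.2 • B *ᵥ u.1), 0, 0)

theorem Ext.bracket_def (u v : Ext A B h) : ⁅u, v⁆ =
    (((u.2.1 • A *ᵥ v.1 + u.2.2 • B *ᵥ v.1) - (v.2.1 • A *ᵥ u.1 + v.2.2 • B *ᵥ u.1), 0, 0) :
      (ι → ℝ) × ℝ × ℝ) := rfl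

instance : LieRing (Ext A B h) where
  add_lie u v w := by
    simp only [Ext.bracket_def]
    refine Prod.ext ?_ (Prod.ext ?_ ?_)
    · change ((u.2.1 + v.2.1) • A *ᵥ w.1 + (u.2.2 + v.2.2) • B *ᵥ w.1) -
        (w.2.1 • A *ᵥ (u.1 + v.1) + w.2.2 • B *ᵥ (u.1 + v.1)) =
        ((u.2.1 • A *ᵥ w.1 + u.2.2 • B *ᵥ w.1) - (w.2.1 • A *ᵥ u.1 + w.2.2 • B *ᵥ u.1)) +
        ((v.2.1 • A *ᵥ w.1 + v.2.2 • B *ᵥ w.1) - (w.2.1 • A *ᵥ v.1 + w.2.2 • B *ᵥ v.1))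
      simp only [Matrix.mulVec_add]
      module
    · exact (add_zero (0 : ℝ)).symm
    · exact (add_zero (0 : ℝ)).symm
  lie_add u v w := by
    simp only [Ext.bracket_def]
    refine Prod.ext ?_ (Prod.ext ?_ ?_)
    · change (u.2.1 • A *ᵥ (v.1 + w.1) + u.2.2 • B *ᵥ (v.1 + w.1)) -
        ((v.2.1 + w.2.1) • A *ᵥ u.1 + (v.2.2 + w.2.2) • B *ᵥ u.1) =
        ((u.2.1 • A *ᵥ v.1 + u.2.2 • B *ᵥ v.1) - (v.2.1 • A *ᵥ u.1 + v.2.2 • B *ᵥ u.1)) +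
        ((u.2.1 • A *ᵥ w.1 + u.2.2 • B *ᵥ w.1) - (w.2.1 • A *ᵥ u.1 + w.2.2 • B *ᵥ u.1))
      simp only [Matrix.mulVec_add]
      module
    · exact (add_zero (0 : ℝ)).symm
    · exact (add_zero (0 : ℝ)).symm
  lie_self u := by
    simp only [Ext.bracket_def, sub_self]
    rfl
  leibniz_lie u v w := by
    have hc : ∀ x : ι → ℝ, B *ᵥ A *ᵥ x = A *ᵥ B *ᵥ x := fun x => by
      rw [Matrix.mulVec_mulVec, Matrix.mulVec_mulVec, h.eq]
    simp only [Ext.bracket_def]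
    refine Prod.ext ?_ (Prod.ext ?_ ?_)
    · change (_ - _ : ι → ℝ) = (_ - _) + (_ - _)
      simp only [Matrix.mulVec_add, Matrix.mulVec_sub, Matrix.mulVec_smul, hc]
      module
    · exact (add_zero (0 : ℝ)).symm
    · exact (add_zero (0 : ℝ)).symm

instance : LieAlgebra ℝ (Ext A B h) where
  lie_smul t u v := by
    simp only [Ext.bracket_def]
    refine Prod.ext ?_ (Prod.ext ?_ ?_)
    · change (u.2.1 • A *ᵥ (t • v.1) + u.2.2 • B *ᵥ (t • v.1)) -
        ((t * v.2.1) • A *ᵥ u.1 + (t * v.2.2) • B *ᵥ u.1) =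
        t • ((u.2.1 • A *ᵥ v.1 + u.2.2 • B *ᵥ v.1) - (v.2.1 • A *ᵥ u.1 + v.2.2 • B *ᵥ u.1))
      simp only [Matrix.mulVec_smul]
      module
    · exact (mul_zero t).symm
    · exact (mul_zero t).symm

end Ext

/-! ### Block matrices whose blocks are noncommutative polynomials -/

/-- A `d × d` array of polynomials in two noncommuting variables. -/
abbrev Template (d : ℕ) : Type := Matrix (Fin d) (Fin d) (FreeAlgebra ℝ (Fin 2))

/-- Substitute the `m × m` matrices `P.1`, `P.2` for the two variables: the result is a
`dm × dm` matrix, made of `d × d` blocks of size `m × m`. -/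
def Template.subst {d : ℕ} (T : Template d) {m : ℕ} (P : MatPair (Fin m)) :
    Matrix (Fin d × Fin m) (Fin d × Fin m) ℝ :=
  Matrix.of fun i j => FreeAlgebra.lift ℝ ![P.1, P.2] (T i.1 j.1) i.2 j.2

end WildLie

end

noncomputable section

namespace WildLie

open Matrix

/-! ### Derived algebras and isomorphisms -/

section LieGeneral

variable {L L' : Type} [LieRing L] [LieAlgebra ℝ L] [LieRing L'] [LieAlgebra ℝ L']

/-! Joint surjectivity makes ℝⁿ the derived algebra of L(A, B), so an isomorphism preserves it. It
restricts to a matrix S on ℝⁿ and induces a matrix g on the two-dimensional quotient; compatibility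
with the brackets is exactly weak similarity through (S, g) (`Ext.nonempty_lieEquiv_iff`).
Conversely, if commuting z, y span a complement of an abelian derived algebra, then ad z and ad y
restrict to commuting matrices A, B, and their images fill the derived algebra because brackets span
it (`exists_lieEquiv_ext`).

For wildness, encode (M, N) in the module over ℝ[x, y]/(x, y)³ generated by W = ℝᵐ with x²w = xy·Mw
+ y²·Nw. It consists of five copies of W, indexed by 1, x, y, xy, y². Let (T, U) act there as (1 +
x, y), and as (0, 1) on a sixth copy. The joint eigenvalues (1, 0) and (0, 1) have multiplicities 5m
and m; traces of powers then force g = 1, so weak similarity becomes similarity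
(`similar_of_weaklySimilar_wild`). As neither eigenvalue is (0, 0), the images of T and U span
(`wild_generate`). The products TU², T(T-1)U and T(T-1)² are multiplication by y², xy and x² on the
five copies and vanish on the sixth. The first two do not involve M, N, so commuting with them makes
the relevant blocks of a similarity equal to one matrix s; the third shows that s conjugates (M, N)
(`similar_of_similar_wild`). These are identities over the free algebra, hence valid for every
substitution, and polynomial in the entries. -/

theorem derivedAlgebra_toSubmodule :
    (derivedAlgebra L).toSubmodule = Submodule.span ℝ {u | ∃ x y : L, ⁅x, y⁆ = u} := by
  have : derivedAlgebra L = ⁅(⊤ : LieIdeal ℝ L), (⊤ : LieIdeal ℝ L)⁆ := by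
    simp [derivedAlgebra]
  rw [this, LieSubmodule.lieIdeal_oper_eq_linear_span']
  congr 1
  ext u
  simp

theorem mem_derivedAlgebra_iff {u : L} :
    u ∈ derivedAlgebra L ↔ u ∈ Submodule.span ℝ {u | ∃ x y : L, ⁅x, y⁆ = u} := by
  rw [← derivedAlgebra_toSubmodule]
  rfl

theorem lie_mem_derivedAlgebra (x y : L) : ⁅x, y⁆ ∈ derivedAlgebra L :=
  mem_derivedAlgebra_iff.2 (Submodule.subset_span ⟨x, y, rfl⟩)

theorem LieEquiv.map_mem_derivedAlgebra (φ : L ≃ₗ⁅ℝ⁆ L') {u : L} (hu : u ∈ derivedAlgebra L) :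
    φ u ∈ derivedAlgebra L' := by
  rw [mem_derivedAlgebra_iff] at hu
  induction hu using Submodule.span_induction with
  | mem x hx =>
    obtain ⟨a, b, rfl⟩ := hx
    rw [LieEquiv.map_lie]
    exact lie_mem_derivedAlgebra _ _
  | zero => simp
  | add x y _ _ hx hy =>
    rw [map_add]
    exact add_mem hx hy
  | smul a x _ hx =>
    rw [map_smul]
    exact (derivedAlgebra L').smul_mem a hx

theorem lie_eq_zero_of_isLieAbelian_derivedAlgebra (h : IsLieAbelian (derivedAlgebra L)) {x y : L}
    (hx : x ∈ derivedAlgebra L) (hy : y ∈ derivedAlgebra L) : ⁅x, y⁆ = 0 := by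
  have := h.trivial ⟨x, hx⟩ ⟨y, hy⟩
  simpa using congrArg Subtype.val this

theorem isSolvable_of_isLieAbelian_derivedAlgebra (h : IsLieAbelian (derivedAlgebra L)) :
    LieAlgebra.IsSolvable L := by
  rw [LieAlgebra.isSolvable_iff ℝ]
  refine ⟨2, ?_⟩
  rw [LieAlgebra.derivedSeries_def, LieAlgebra.derivedSeriesOfIdeal_succ]
  change ⁅derivedAlgebra L, derivedAlgebra L⁆ = ⊥
  rw [LieSubmodule.lie_eq_bot_iff]
  intro x hx y hy
  exact lie_eq_zero_of_isLieAbelian_derivedAlgebra h hx hy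

end LieGeneral

/-! ### Structure of the algebra of a commuting pair -/

theorem jointlySurjective_iff {ι : Type} [Fintype ι] {P : MatPair ι} :
    JointlySurjective P ↔ ∀ x : ι → ℝ, ∃ a b, x = P.1 *ᵥ a + P.2 *ᵥ b := by
  rw [JointlySurjective, eq_top_iff]
  constructor
  · intro h x
    obtain ⟨_, ⟨a, rfl⟩, _, ⟨b, rfl⟩, hab⟩ := Submodule.mem_sup.1 (h (Submodule.mem_top (x := x)))
    exact ⟨a, b, hab.symm⟩
  · intro h x _
    obtain ⟨a, b, rfl⟩ := h x
    exact add_mem (Submodule.mem_sup_left ⟨a, rfl⟩) (Submodule.mem_sup_right ⟨b, rfl⟩)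

section ExtStructure

variable {ι : Type} [Fintype ι] {A B : Matrix ι ι ℝ} {h : Commute A B}

/-- The element `x + s z + t y`. -/
def Ext.mk (A B : Matrix ι ι ℝ) (h : Commute A B) (x : ι → ℝ) (s t : ℝ) : Ext A B h := (x, s, t)

/-- The underlying vector space. -/
def Ext.toProd (A B : Matrix ι ι ℝ) (h : Commute A B) : Ext A B h ≃ₗ[ℝ] (ι → ℝ) × ℝ × ℝ :=
  LinearEquiv.refl ℝ ((ι → ℝ) × ℝ × ℝ)

theorem Ext.toProd_mk (x : ι → ℝ) (s t : ℝ) : Ext.toProd A B h (Ext.mk A B h x s t) = (x, s, t) :=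
  rfl

theorem Ext.lie_mk (x x' : ι → ℝ) (s t s' t' : ℝ) :
    ⁅Ext.mk A B h x s t, Ext.mk A B h x' s' t'⁆ =
      Ext.mk A B h ((s • A *ᵥ x' + t • B *ᵥ x') - (s' • A *ᵥ x + t' • B *ᵥ x)) 0 0 := rfl

theorem Ext.mk_add_mk (x x' : ι → ℝ) (s t s' t' : ℝ) :
    Ext.mk A B h x s t + Ext.mk A B h x' s' t' = Ext.mk A B h (x + x') (s + s') (t + t') := rfl

theorem Ext.mk_smul (c : ℝ) (x : ι → ℝ) (s t : ℝ) :
    c • Ext.mk A B h x s t = Ext.mk A B h (c • x) (c * s) (c * t) := rfl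

theorem Ext.exists_eq_mk (u : Ext A B h) : ∃ x s t, u = Ext.mk A B h x s t := ⟨u.1, u.2.1, u.2.2, rfl⟩

theorem Ext.mk_inj {x x' : ι → ℝ} {s t s' t' : ℝ} :
    Ext.mk A B h x s t = Ext.mk A B h x' s' t' ↔ x = x' ∧ s = s' ∧ t = t' := by
  rw [← (Ext.toProd A B h).injective.eq_iff]
  simp [Ext.toProd_mk]

/-- The abelian ideal `ℝⁿ`. -/
def Ext.inclusion (A B : Matrix ι ι ℝ) (h : Commute A B) : (ι → ℝ) →ₗ[ℝ] Ext A B h :=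
  (Ext.toProd A B h).symm.toLinearMap ∘ₗ LinearMap.inl ℝ (ι → ℝ) (ℝ × ℝ)

theorem Ext.inclusion_apply (x : ι → ℝ) : Ext.inclusion A B h x = Ext.mk A B h x 0 0 := rfl

theorem Ext.inclusion_injective : Function.Injective (Ext.inclusion A B h) := fun x y hxy => by
  simpa [Ext.inclusion_apply, Ext.mk_inj] using hxy

/-- All brackets lie in ℝⁿ, and those with z and y already produce Im A and Im B. -/
theorem Ext.derivedAlgebra_eq_range (hs : JointlySurjective (A, B)) :
    (derivedAlgebra (Ext A B h)).toSubmodule = LinearMap.range (Ext.inclusion A B h) := by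
  rw [derivedAlgebra_toSubmodule]
  apply le_antisymm
  · rw [Submodule.span_le]
    rintro _ ⟨u, v, rfl⟩
    exact ⟨_, rfl⟩
  · rintro _ ⟨x, rfl⟩
    obtain ⟨a, b, rfl⟩ := jointlySurjective_iff.1 hs x
    rw [map_add]
    refine add_mem (Submodule.subset_span ⟨Ext.mk A B h 0 1 0, Ext.mk A B h a 0 0, ?_⟩)
      (Submodule.subset_span ⟨Ext.mk A B h 0 0 1, Ext.mk A B h b 0 0, ?_⟩) <;>
    simp [Ext.lie_mk, Ext.inclusion_apply]

theorem Ext.mem_derivedAlgebra_iff (hs : JointlySurjective (A, B)) {u : Ext A B h} :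
    u ∈ derivedAlgebra (Ext A B h) ↔ ∃ x, u = Ext.mk A B h x 0 0 := by
  rw [← LieSubmodule.mem_toSubmodule, Ext.derivedAlgebra_eq_range hs]
  simp [Ext.inclusion_apply, eq_comm]

theorem Ext.finrank_eq : Module.finrank ℝ (Ext A B h) = Fintype.card ι + 2 := by
  rw [(Ext.toProd A B h).finrank_eq]
  simp

theorem Ext.isLieCZ (hn : 2 ≤ Fintype.card ι) (hs : JointlySurjective (A, B)) :
    IsLieCZ (Fintype.card ι) (Ext A B h) := by
  have hab : IsLieAbelian (derivedAlgebra (Ext A B h)) := by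
    refine ⟨?_⟩
    rintro ⟨u, hu⟩ ⟨v, hv⟩
    obtain ⟨x, rfl⟩ := (Ext.mem_derivedAlgebra_iff hs).1 hu
    obtain ⟨y, rfl⟩ := (Ext.mem_derivedAlgebra_iff hs).1 hv
    apply Subtype.ext
    change ⁅Ext.mk A B h x 0 0, Ext.mk A B h y 0 0⁆ = Ext.mk A B h 0 0 0
    simp [Ext.lie_mk]
  refine ⟨⟨⟨hn, isSolvable_of_isLieAbelian_derivedAlgebra hab, Ext.finrank_eq, ?_⟩, hab⟩,
    Ext.mk A B h 0 1 0, Ext.mk A B h 0 0 1, ?_, ?_⟩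
  · change Module.finrank ℝ (derivedAlgebra (Ext A B h)).toSubmodule = _
    rw [Ext.derivedAlgebra_eq_range hs, LinearMap.finrank_range_of_inj Ext.inclusion_injective]
    simp
  · change _ = Ext.mk A B h 0 0 0
    simp [Ext.lie_mk]
  · rw [Ext.derivedAlgebra_eq_range hs, isCompl_iff, Submodule.disjoint_def, codisjoint_iff,
      eq_top_iff]
    constructor
    · rintro u hu ⟨x, rfl⟩
      obtain ⟨a, b, hab⟩ := Submodule.mem_span_pair.1 hu
      change Ext.mk A B h (a • 0 + b • 0) (a * 1 + b * 0) (a * 0 + b * 1) = Ext.mk A B h x 0 0 at hab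
      simp only [Ext.mk_inj] at hab
      rw [← hab.1]
      simp
    · intro u _
      refine Submodule.mem_sup.2 ⟨Ext.mk A B h 0 u.2.1 u.2.2,
        Submodule.mem_span_pair.2 ⟨u.2.1, u.2.2, ?_⟩, Ext.mk A B h u.1 0 0, ⟨u.1, rfl⟩, ?_⟩
      · change Ext.mk A B h (u.2.1 • 0 + u.2.2 • 0) (u.2.1 * 1 + u.2.2 * 0)
          (u.2.1 * 0 + u.2.2 * 1) = _
        simp
      · rw [Ext.mk_add_mk]
        change _ = Ext.mk A B h u.1 u.2.1 u.2.2
        simp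

end ExtStructure

/-! ### Isomorphism is weak similarity -/

section Isomorphism

variable {ι : Type} [Fintype ι] {A B A' B' : Matrix ι ι ℝ}
  {h : Commute A B} {h' : Commute A' B'}

/-- The linear map between extensions induced by a matrix `S` of the abelian ideals and a
matrix `g` of the complements. -/
def Ext.linearMap (A B : Matrix ι ι ℝ) (h : Commute A B) (A' B' : Matrix ι ι ℝ)
    (h' : Commute A' B') (S : Matrix ι ι ℝ) (g : Matrix (Fin 2) (Fin 2) ℝ) :
    Ext A B h →ₗ[ℝ] Ext A' B' h' where
  toFun u := Ext.mk A' B' h' (S *ᵥ u.1) (u.2.1 * g 0 0 + u.2.2 * g 1 0)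
    (u.2.1 * g 0 1 + u.2.2 * g 1 1)
  map_add' u v := by
    obtain ⟨x, s, t, rfl⟩ := u.exists_eq_mk
    obtain ⟨x', s', t', rfl⟩ := v.exists_eq_mk
    rw [Ext.mk_add_mk, Ext.mk_add_mk, Ext.mk_inj]
    simp only [Ext.mk, Matrix.mulVec_add, true_and]
    constructor <;> ring
  map_smul' c u := by
    obtain ⟨x, s, t, rfl⟩ := u.exists_eq_mk
    rw [RingHom.id_apply, Ext.mk_smul, Ext.mk_smul, Ext.mk_inj]
    simp only [Ext.mk, Matrix.mulVec_smul, true_and]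
    constructor <;> ring

theorem Ext.linearMap_mk (S : Matrix ι ι ℝ) (g : Matrix (Fin 2) (Fin 2) ℝ) (x : ι → ℝ) (s t : ℝ) :
    Ext.linearMap A B h A' B' h' S g (Ext.mk A B h x s t) =
      Ext.mk A' B' h' (S *ᵥ x) (s * g 0 0 + t * g 1 0) (s * g 0 1 + t * g 1 1) := rfl

variable [DecidableEq ι]

/-- The matrix g acts on row vectors (s, t) from the right, hence the opposite orders of the factors
in `hS` and `hg`. -/
theorem Ext.linearMap_linearMap {S S' : Matrix ι ι ℝ} {g g' : Matrix (Fin 2) (Fin 2) ℝ}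
    (hS : S' * S = 1) (hg : g * g' = 1) (u : Ext A B h) :
    Ext.linearMap A' B' h' A B h S' g' (Ext.linearMap A B h A' B' h' S g u) = u := by
  obtain ⟨x, s, t, rfl⟩ := u.exists_eq_mk
  have e := fun i j => congrFun (congrFun hg i) j
  simp only [Matrix.mul_apply, Fin.sum_univ_two] at e
  have e₀₀ := e 0 0
  have e₀₁ := e 0 1
  have e₁₀ := e 1 0
  have e₁₁ := e 1 1
  simp only [Matrix.one_apply_eq, ne_eq, Matrix.one_apply_ne, zero_ne_one, one_ne_zero,
    not_false_eq_true] at e₀₀ e₀₁ e₁₀ e₁₁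
  rw [Ext.linearMap_mk, Ext.linearMap_mk, Ext.mk_inj]
  refine ⟨by rw [Matrix.mulVec_mulVec, hS, Matrix.one_mulVec], ?_, ?_⟩
  · linear_combination s * e₀₀ + t * e₁₀
  · linear_combination s * e₀₁ + t * e₁₁

/-- Applying the map to [z, x] and [y, x] expresses A and B through A' and B', which is why the
pairs appear in reversed order. -/
theorem Ext.nonempty_lieEquiv_of_weaklySimilar (hw : WeaklySimilar (A', B') (A, B)) :
    Nonempty (Ext A B h ≃ₗ⁅ℝ⁆ Ext A' B' h') := by
  obtain ⟨S, g, h₁, h₂⟩ := hw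
  have hA : ∀ x, S.1 *ᵥ A *ᵥ x = g.1 0 0 • A' *ᵥ S.1 *ᵥ x + g.1 0 1 • B' *ᵥ S.1 *ᵥ x := fun x => by
    have : S.1 * A = (g.1 0 0 • A' + g.1 0 1 • B') * S.1 := by
      rw [show A = _ from h₁, mul_assoc, Units.mul_inv_cancel_left]
    rw [Matrix.mulVec_mulVec, this, ← Matrix.mulVec_mulVec, Matrix.add_mulVec, Matrix.smul_mulVec,
      Matrix.smul_mulVec]
  have hB : ∀ x, S.1 *ᵥ B *ᵥ x = g.1 1 0 • A' *ᵥ S.1 *ᵥ x + g.1 1 1 • B' *ᵥ S.1 *ᵥ x := fun x => by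
    have : S.1 * B = (g.1 1 0 • A' + g.1 1 1 • B') * S.1 := by
      rw [show B = _ from h₂, mul_assoc, Units.mul_inv_cancel_left]
    rw [Matrix.mulVec_mulVec, this, ← Matrix.mulVec_mulVec, Matrix.add_mulVec, Matrix.smul_mulVec,
      Matrix.smul_mulVec]
  refine ⟨{
    Ext.linearMap A B h A' B' h' S.1 g.1 with
    map_lie' := ?_
    invFun := Ext.linearMap A' B' h' A B h S.2 g.2
    left_inv := fun u => Ext.linearMap_linearMap S.inv_mul g.mul_inv u
    right_inv := fun u => Ext.linearMap_linearMap S.mul_inv g.inv_mul u }⟩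
  intro u v
  obtain ⟨x, s, t, rfl⟩ := u.exists_eq_mk
  obtain ⟨x', s', t', rfl⟩ := v.exists_eq_mk
  change Ext.linearMap A B h A' B' h' S.1 g.1 _ = ⁅Ext.linearMap A B h A' B' h' S.1 g.1 _,
    Ext.linearMap A B h A' B' h' S.1 g.1 _⁆
  rw [Ext.lie_mk, Ext.linearMap_mk, Ext.linearMap_mk, Ext.linearMap_mk, Ext.lie_mk, Ext.mk_inj]
  refine ⟨?_, by ring, by ring⟩
  simp only [Matrix.mulVec_sub, Matrix.mulVec_add, Matrix.mulVec_smul, hA, hB]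
  module

theorem Ext.weaklySimilar_of_lieEquiv (hs : JointlySurjective (A, B))
    (hs' : JointlySurjective (A', B')) (φ : Ext A B h ≃ₗ⁅ℝ⁆ Ext A' B' h') :
    WeaklySimilar (A', B') (A, B) := by
  -- Stated for an arbitrary isomorphism so that it also applies to the inverse, which supplies the
  -- inverses of S and g.
  have key : ∀ {A B A' B' : Matrix ι ι ℝ} {h : Commute A B} {h' : Commute A' B'}
      (_ : JointlySurjective (A, B)) (_ : JointlySurjective (A', B'))
      (φ : Ext A B h ≃ₗ⁅ℝ⁆ Ext A' B' h'), ∃ (S : Matrix ι ι ℝ) (g : Matrix (Fin 2) (Fin 2) ℝ),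
      (∀ x, φ (Ext.mk A B h x 0 0) = Ext.mk A' B' h' (S *ᵥ x) 0 0) ∧
      ∀ s t, ∃ y, φ (Ext.mk A B h 0 s t) =
        Ext.mk A' B' h' y (s * g 0 0 + t * g 1 0) (s * g 0 1 + t * g 1 1) := by
    intro A B A' B' h h' hs hs' φ
    let f : (ι → ℝ) →ₗ[ℝ] (ι → ℝ) := LinearMap.fst ℝ _ _ ∘ₗ (Ext.toProd A' B' h').toLinearMap ∘ₗ
      (φ : Ext A B h →ₗ[ℝ] Ext A' B' h') ∘ₗ Ext.inclusion A B h
    let G : Ext A B h →ₗ[ℝ] ℝ × ℝ := LinearMap.snd ℝ _ _ ∘ₗ (Ext.toProd A' B' h').toLinearMap ∘ₗ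
      (φ : Ext A B h →ₗ[ℝ] Ext A' B' h')
    refine ⟨LinearMap.toMatrix' f, !![(G (Ext.mk A B h 0 1 0)).1, (G (Ext.mk A B h 0 1 0)).2;
      (G (Ext.mk A B h 0 0 1)).1, (G (Ext.mk A B h 0 0 1)).2], fun x => ?_, fun s t => ?_⟩
    · obtain ⟨y, hy⟩ := (Ext.mem_derivedAlgebra_iff hs').1
        (LieEquiv.map_mem_derivedAlgebra φ ((Ext.mem_derivedAlgebra_iff (h := h) hs).2 ⟨x, rfl⟩))
      rw [← Matrix.toLin'_apply, Matrix.toLin'_toMatrix', hy, Ext.mk_inj]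
      refine ⟨?_, rfl, rfl⟩
      change y = (φ (Ext.mk A B h x 0 0)).1
      rw [hy]
      rfl
    · obtain ⟨y, a, b, hy⟩ := (φ (Ext.mk A B h 0 s t)).exists_eq_mk
      refine ⟨y, hy.trans (Ext.mk_inj.2 ⟨rfl, ?_⟩)⟩
      have hG : G (Ext.mk A B h 0 s t) = (a, b) := by
        change (φ (Ext.mk A B h 0 s t)).2 = _
        rw [hy]
        rfl
      have : Ext.mk A B h 0 s t = s • Ext.mk A B h 0 1 0 + t • Ext.mk A B h 0 0 1 := by
        simp [Ext.mk_smul, Ext.mk_add_mk]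
      rw [this, map_add, map_smul, map_smul, Prod.ext_iff] at hG
      simpa [eq_comm] using hG
  obtain ⟨S, g, hS, hg⟩ := key hs hs' φ
  obtain ⟨S', g', hS', hg'⟩ := key hs' hs φ.symm
  have hSS : S' * S = 1 := by
    refine Matrix.toLin'.injective (LinearMap.ext fun x => ?_)
    have := φ.symm_apply_apply (Ext.mk A B h x 0 0)
    rw [hS, hS', Ext.mk_inj] at this
    simpa [Matrix.toLin'_apply, ← Matrix.mulVec_mulVec] using this.1
  have hgg : g * g' = 1 := by
    have e : ∀ s t, ((s * g 0 0 + t * g 1 0) * g' 0 0 + (s * g 0 1 + t * g 1 1) * g' 1 0 = s) ∧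
        ((s * g 0 0 + t * g 1 0) * g' 0 1 + (s * g 0 1 + t * g 1 1) * g' 1 1 = t) := by
      intro s t
      obtain ⟨y, hy⟩ := hg s t
      obtain ⟨z, hz⟩ := hg' (s * g 0 0 + t * g 1 0) (s * g 0 1 + t * g 1 1)
      have := φ.symm_apply_apply (Ext.mk A B h 0 s t)
      -- The component y in the ideal is sent back into the ideal, so it does not affect the
      -- quotient coordinates.
      have split : ∀ a b, Ext.mk A' B' h' y a b = Ext.mk A' B' h' y 0 0 + Ext.mk A' B' h' 0 a b :=
        fun a b => by simp [Ext.mk_add_mk]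
      rw [hy, split, map_add, hS', hz, Ext.mk_add_mk, Ext.mk_inj] at this
      simpa using this.2
    ext i j
    fin_cases i <;> fin_cases j
    · simpa [Matrix.mul_apply, Fin.sum_univ_two] using (e 1 0).1
    · simpa [Matrix.mul_apply, Fin.sum_univ_two] using (e 1 0).2
    · simpa [Matrix.mul_apply, Fin.sum_univ_two] using (e 0 1).1
    · simpa [Matrix.mul_apply, Fin.sum_univ_two] using (e 0 1).2
  have hint : ∀ s t, S * (s • A + t • B) =
      ((s * g 0 0 + t * g 1 0) • A' + (s * g 0 1 + t * g 1 1) • B') * S := by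
    intro s t
    refine Matrix.toLin'.injective (LinearMap.ext fun x => ?_)
    obtain ⟨y, hy⟩ := hg s t
    -- The unknown y drops out of the bracket because the ideal is abelian.
    have := φ.map_lie (Ext.mk A B h 0 s t) (Ext.mk A B h x 0 0)
    rw [Ext.lie_mk, hS, hy, hS, Ext.lie_mk] at this
    simpa [Ext.mk_inj, Matrix.toLin'_apply, ← Matrix.mulVec_mulVec, Matrix.add_mulVec,
      Matrix.smul_mulVec] using this
  let u : GL ι ℝ := ⟨S, S', mul_eq_one_comm.1 hSS, hSS⟩
  refine ⟨u, ⟨g, g', hgg, mul_eq_one_comm.1 hgg⟩, ?_, ?_⟩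
  · rw [mul_assoc]
    refine ((Units.inv_mul_eq_iff_eq_mul u).2 ?_).symm
    simpa using (hint 1 0).symm
  · rw [mul_assoc]
    refine ((Units.inv_mul_eq_iff_eq_mul u).2 ?_).symm
    simpa using (hint 0 1).symm

/-- Passing to the inverse isomorphism undoes the reversal of the pairs, so symmetry of weak
similarity is not needed. -/
theorem Ext.nonempty_lieEquiv_iff (hs : JointlySurjective (A, B))
    (hs' : JointlySurjective (A', B')) :
    Nonempty (Ext A B h ≃ₗ⁅ℝ⁆ Ext A' B' h') ↔ WeaklySimilar (A, B) (A', B') :=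
  ⟨fun ⟨φ⟩ => Ext.weaklySimilar_of_lieEquiv hs' hs φ.symm, fun hw => by
    obtain ⟨φ⟩ := Ext.nonempty_lieEquiv_of_weaklySimilar (h := h') (h' := h) hw
    exact ⟨φ.symm⟩⟩

end Isomorphism

/-! ### Every algebra of the class comes from a commuting pair -/

section Classification

variable {n : ℕ} {L : Type} [LieRing L] [LieAlgebra ℝ L]

theorem exists_lieEquiv_ext (hL : IsLieCZ n L) :
    ∃ (A B : Matrix (Fin n) (Fin n) ℝ) (h : Commute A B),
      JointlySurjective (A, B) ∧ Nonempty (L ≃ₗ⁅ℝ⁆ Ext A B h) := by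
  obtain ⟨⟨⟨hn, -, hdim, hder⟩, hab⟩, z, y, hzy, hc⟩ := hL
  -- `finrank` is 0 in infinite dimension, so the value n + 2 forces finiteness.
  have : FiniteDimensional ℝ L := Module.finite_of_finrank_pos (by omega)
  set D := (derivedAlgebra L).toSubmodule with hD
  have hder : Module.finrank ℝ D = n := hder
  let e : (Fin n → ℝ) ≃ₗ[ℝ] D := LinearEquiv.ofFinrankEq _ _ (by simp [hder])
  have hmem : ∀ u v : L, ⁅u, v⁆ ∈ D := lie_mem_derivedAlgebra
  let ad (u : L) : (Fin n → ℝ) →ₗ[ℝ] (Fin n → ℝ) := e.symm.toLinearMap ∘ₗ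
    LinearMap.codRestrict D ((LieAlgebra.ad ℝ L u : L →ₗ[ℝ] L) ∘ₗ D.subtype ∘ₗ e.toLinearMap)
      (fun x => hmem _ _)
  have hadm : ∀ u x, ((e (LinearMap.toMatrix' (ad u) *ᵥ x) : D) : L) = ⁅u, (e x : L)⁆ := by
    intro u x
    rw [← Matrix.toLin'_apply, Matrix.toLin'_toMatrix']
    simp [ad]
    rfl
  have hinj : ∀ {x x' : Fin n → ℝ}, ((e x : D) : L) = e x' → x = x' :=
    fun hx => e.injective (Subtype.ext hx)
  set A := LinearMap.toMatrix' (ad z) with hA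
  set B := LinearMap.toMatrix' (ad y) with hB
  have hz : ∀ x, ((e (A *ᵥ x) : D) : L) = ⁅z, (e x : L)⁆ := hadm z
  have hy : ∀ x, ((e (B *ᵥ x) : D) : L) = ⁅y, (e x : L)⁆ := hadm y
  -- Jacobi identity with [z, y] = 0.
  have hcomm : Commute A B := by
    refine Matrix.toLin'.injective (LinearMap.ext fun x => hinj ?_)
    rw [Matrix.toLin'_apply, Matrix.toLin'_apply, ← Matrix.mulVec_mulVec, ← Matrix.mulVec_mulVec,
      hz, hy, hy, hz, leibniz_lie z y, hzy, zero_lie, zero_add]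
  have hDD : ∀ x x', ⁅((e x : D) : L), ((e x' : D) : L)⁆ = 0 := fun x x' =>
    lie_eq_zero_of_isLieAbelian_derivedAlgebra hab (e x).2 (e x').2
  let f : Ext A B hcomm →ₗ[ℝ] L :=
    (LinearMap.coprod (D.subtype ∘ₗ e.toLinearMap)
      (LinearMap.coprod (LinearMap.toSpanSingleton ℝ L z) (LinearMap.toSpanSingleton ℝ L y))) ∘ₗ
      (Ext.toProd A B hcomm).toLinearMap
  have hf : ∀ x s t, f (Ext.mk A B hcomm x s t) = e x + (s • z + t • y) := fun _ _ _ => rfl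
  have hzz : ⁅y, z⁆ = 0 := by rw [← lie_skew, hzy, neg_zero]
  have hlie : ∀ u v, f ⁅u, v⁆ = ⁅f u, f v⁆ := by
    intro u v
    obtain ⟨x, s, t, rfl⟩ := u.exists_eq_mk
    obtain ⟨x', s', t', rfl⟩ := v.exists_eq_mk
    rw [Ext.lie_mk, hf, hf, hf]
    simp only [map_sub, map_add, map_smul, Submodule.coe_sub, Submodule.coe_add, Submodule.coe_smul,
      hz, hy, lie_add, add_lie, lie_smul, smul_lie, hDD, hzy, hzz, lie_self]
    rw [← lie_skew (e x : L) z, ← lie_skew (e x : L) y]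
    module
  have hsurj : Function.Surjective f := by
    intro u
    obtain ⟨v, hv, w, hw, rfl⟩ := Submodule.mem_sup.1
      ((codisjoint_iff.1 hc.codisjoint).ge (Submodule.mem_top (x := u)))
    obtain ⟨s, t, rfl⟩ := Submodule.mem_span_pair.1 hv
    refine ⟨Ext.mk A B hcomm (e.symm ⟨w, hw⟩) s t, ?_⟩
    rw [hf, LinearEquiv.apply_symm_apply, add_comm]
  have hfin : Module.finrank ℝ (Ext A B hcomm) = Module.finrank ℝ L := by
    rw [Ext.finrank_eq, hdim, Fintype.card_fin]
  have : FiniteDimensional ℝ (Ext A B hcomm) := Module.finite_of_finrank_pos (by omega)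
  have hbij : Function.Bijective f :=
    ⟨(LinearMap.injective_iff_surjective_of_finrank_eq_finrank hfin).2 hsurj, hsurj⟩
  let F : Ext A B hcomm →ₗ⁅ℝ⁆ L := { f with map_lie' := fun {u v} => hlie u v }
  refine ⟨A, B, hcomm, ?_, ⟨(LieEquiv.ofBijective F hbij).symm⟩⟩
  rw [jointlySurjective_iff]
  -- Every bracket, computed in the model, lies in Im A + Im B, and brackets span D.
  have hspan : D ≤ ((LinearMap.range A.mulVecLin ⊔ LinearMap.range B.mulVecLin).map
      (D.subtype ∘ₗ e.toLinearMap)) := by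
    refine derivedAlgebra_toSubmodule.le.trans (Submodule.span_le.2 ?_)
    rintro _ ⟨u, v, rfl⟩
    obtain ⟨u, rfl⟩ := hsurj u
    obtain ⟨v, rfl⟩ := hsurj v
    rw [SetLike.mem_coe, ← hlie]
    obtain ⟨x, s, t, rfl⟩ := u.exists_eq_mk
    obtain ⟨x', s', t', rfl⟩ := v.exists_eq_mk
    rw [Ext.lie_mk, hf]
    simp only [zero_smul, add_zero]
    refine Submodule.mem_map_of_mem (sub_mem ?_ ?_) <;>
    exact add_mem (Submodule.mem_sup_left (Submodule.smul_mem _ _ ⟨_, rfl⟩))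
      (Submodule.mem_sup_right (Submodule.smul_mem _ _ ⟨_, rfl⟩))
  intro x
  obtain ⟨w, hw, hwx⟩ := hspan (e x).2
  obtain rfl : w = x := hinj hwx
  obtain ⟨_, ⟨a, rfl⟩, _, ⟨b, rfl⟩, hab⟩ := Submodule.mem_sup.1 hw
  exact ⟨a, b, hab.symm⟩

end Classification

/-! ### Substitution into block matrices -/

section TemplateAlgebra

variable {d m : ℕ}

/-- Substitution is a ring homomorphism. -/
def substHom (d : ℕ) {m : ℕ} (P : MatPair (Fin m)) :
    Template d →+* Matrix (Fin d × Fin m) (Fin d × Fin m) ℝ :=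
  (Matrix.compRingEquiv (Fin d) (Fin m) ℝ).toRingHom.comp
    (RingHom.mapMatrix (FreeAlgebra.lift ℝ ![P.1, P.2]).toRingHom)

theorem substHom_apply (T : Template d) (P : MatPair (Fin m)) : substHom d P T = T.subst P := rfl

theorem Template.subst_smul (a : ℝ) (T : Template d) (P : MatPair (Fin m)) :
    (a • T).subst P = a • T.subst P := by
  ext i j
  simp [Template.subst]

theorem Template.subst_add (T U : Template d) (P : MatPair (Fin m)) :
    (T + U).subst P = T.subst P + U.subst P := map_add (substHom d P) T U

theorem Template.subst_pow (T : Template d) (k : ℕ) (P : MatPair (Fin m)) :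
    (T ^ k).subst P = T.subst P ^ k := map_pow (substHom d P) T k

theorem trace_subst (T : Template d) (P : MatPair (Fin m)) :
    (T.subst P).trace = ∑ i, (FreeAlgebra.lift ℝ ![P.1, P.2] (T i i)).trace := by
  simp [Matrix.trace, Fintype.sum_prod_type, Template.subst]

/-- The block diagonal matrix with all blocks equal to `S`, as an invertible matrix. -/
def blockDiag (d : ℕ) (S : GL (Fin m) ℝ) : GL (Fin d × Fin m) ℝ :=
  Units.map (((Matrix.compRingEquiv (Fin d) (Fin m) ℝ).toRingHom.comp
    (Matrix.scalar (Fin d))) : Matrix (Fin m) (Fin m) ℝ →+* _).toMonoidHom S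

/-- Conjugation is an algebra automorphism, so it commutes with evaluating noncommutative
polynomials. -/
theorem lift_conj (P : MatPair (Fin m)) (S : GL (Fin m) ℝ) (a : FreeAlgebra ℝ (Fin 2)) :
    FreeAlgebra.lift ℝ ![(↑S⁻¹ : Matrix _ _ ℝ) * P.1 * (S : Matrix _ _ ℝ),
      (↑S⁻¹ : Matrix _ _ ℝ) * P.2 * (S : Matrix _ _ ℝ)] a =
    (↑S⁻¹ : Matrix _ _ ℝ) * FreeAlgebra.lift ℝ ![P.1, P.2] a * (S : Matrix _ _ ℝ) := by
  induction a using FreeAlgebra.induction with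
  | grade0 r =>
    simp only [AlgHom.commutes]
    rw [← Algebra.commutes, mul_assoc, Units.inv_mul, mul_one]
  | grade1 i => fin_cases i <;> simp
  | mul a b ha hb =>
    rw [map_mul, map_mul, ha, hb]
    simp only [mul_assoc]
    rw [Units.mul_inv_cancel_left]
  | add a b ha hb => simp only [map_add, ha, hb, mul_add, add_mul]

theorem Template.subst_conj (T : Template d) {P P' : MatPair (Fin m)} {S : GL (Fin m) ℝ}
    (h₁ : P'.1 = (↑S⁻¹ : Matrix _ _ ℝ) * P.1 * (S : Matrix _ _ ℝ))
    (h₂ : P'.2 = (↑S⁻¹ : Matrix _ _ ℝ) * P.2 * (S : Matrix _ _ ℝ)) :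
    T.subst P' = (↑(blockDiag d S)⁻¹ : Matrix _ _ ℝ) * T.subst P *
      (blockDiag d S : Matrix _ _ ℝ) := by
  have hS : ∀ S : GL (Fin m) ℝ, (blockDiag d S : Matrix _ _ ℝ) =
    Matrix.compRingEquiv (Fin d) (Fin m) ℝ (Matrix.scalar (Fin d) (S : Matrix _ _ ℝ)) :=
    fun _ => rfl
  have hinv : (blockDiag d S)⁻¹ = blockDiag d S⁻¹ := by simp [blockDiag]
  rw [hinv, hS, hS, ← substHom_apply, ← substHom_apply]
  simp only [substHom, RingHom.comp_apply]
  change _ = Matrix.compRingEquiv (Fin d) (Fin m) ℝ _ * Matrix.compRingEquiv (Fin d) (Fin m) ℝ _ *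
    Matrix.compRingEquiv (Fin d) (Fin m) ℝ _
  rw [← map_mul, ← map_mul]
  refine congrArg (Matrix.compRingEquiv (Fin d) (Fin m) ℝ) ?_
  ext1 i j
  simp only [Matrix.scalar_apply, Matrix.mul_diagonal, Matrix.diagonal_mul, RingHom.mapMatrix_apply,
    Matrix.map_apply]
  rw [h₁, h₂]
  exact lift_conj P S _

theorem weaklySimilar_of_similar {ι : Type} [Fintype ι] [DecidableEq ι] {P P' : MatPair ι}
    (h : Similar P P') : WeaklySimilar P P' := by
  obtain ⟨S, h₁, h₂⟩ := h
  exact ⟨S, 1, by simpa using h₁, by simpa using h₂⟩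

theorem weaklySimilar_subst_of_similar (T U : Template d) {P P' : MatPair (Fin m)}
    (h : Similar P P') : WeaklySimilar (T.subst P, U.subst P) (T.subst P', U.subst P') := by
  obtain ⟨S, h₁, h₂⟩ := h
  exact weaklySimilar_of_similar ⟨blockDiag d S, T.subst_conj h₁ h₂, U.subst_conj h₁ h₂⟩

theorem mul_apply_of_lowerTriangular {R : Type*} [Ring R] {T U : Matrix (Fin d) (Fin d) R}
    (hT : ∀ i j, i < j → T i j = 0) (hU : ∀ i j, i < j → U i j = 0) :
    (∀ i j, i < j → (T * U) i j = 0) ∧ ∀ i, (T * U) i i = T i i * U i i := by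
  constructor
  · intro i j hij
    rw [Matrix.mul_apply]
    refine Finset.sum_eq_zero fun k _ => ?_
    rcases lt_or_ge i k with hk | hk
    · rw [hT i k hk, zero_mul]
    · rw [hU k j (hk.trans_lt hij), mul_zero]
  · intro i
    rw [Matrix.mul_apply]
    refine Finset.sum_eq_single i (fun k _ hk => ?_) (by simp)
    rcases lt_or_gt_of_ne hk with hk | hk
    · rw [hU k i hk, mul_zero]
    · rw [hT i k hk, zero_mul]

theorem pow_apply_of_lowerTriangular {R : Type*} [Ring R] {T : Matrix (Fin d) (Fin d) R}
    (hT : ∀ i j, i < j → T i j = 0) (k : ℕ) :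
    (∀ i j, i < j → (T ^ k) i j = 0) ∧ ∀ i, (T ^ k) i i = T i i ^ k := by
  induction k with
  | zero => exact ⟨fun i j h => by simp [h.ne], fun i => by simp⟩
  | succ k ih =>
    rw [pow_succ]
    have := mul_apply_of_lowerTriangular ih.1 hT
    exact ⟨this.1, fun i => by rw [this.2, ih.2, pow_succ]⟩

end TemplateAlgebra

/-! ### The wild templates and their identities -/

section WildTemplates

open FreeAlgebra

/-- Multiplication by `1 + x` on the module over `ℝ[x, y] / (x, y)³` generated by a space `W` with
relations `x² w = x y M w + y² N w`, extended by `0` on one more copy of `W`. -/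
def wildT : Template 6 :=
  !![1, 0, 0, 0, 0, 0;
     1, 1, 0, 0, 0, 0;
     0, 0, 1, 0, 0, 0;
     0, ι ℝ 0, 1, 1, 0, 0;
     0, ι ℝ 1, 0, 0, 1, 0;
     0, 0, 0, 0, 0, 0]

/-- Multiplication by `y` on the same module, extended by `1` on one more copy of `W`. -/
def wildU : Template 6 :=
  !![0, 0, 0, 0, 0, 0;
     0, 0, 0, 0, 0, 0;
     1, 0, 0, 0, 0, 0;
     0, 1, 0, 0, 0, 0;
     0, 0, 1, 0, 0, 0;
     0, 0, 0, 0, 0, 1]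

theorem wild_commute : wildT * wildU = wildU * wildT := by
  ext1 i j
  fin_cases i <;> fin_cases j <;> simp [wildT, wildU, Matrix.mul_apply, Fin.sum_univ_succ]

/-- This is multiplication by (1 + x)y² = y²; the factor `wildT` kills the sixth block. The next
identities use it in the same way to isolate xy and x². -/
theorem wildT_mul_wildU_sq : wildT * (wildU * wildU) = Matrix.single 4 0 1 := by
  have : wildU * wildU = !![0, 0, 0, 0, 0, 0; 0, 0, 0, 0, 0, 0; 0, 0, 0, 0, 0, 0;
      0, 0, 0, 0, 0, 0; 1, 0, 0, 0, 0, 0; 0, 0, 0, 0, 0, (1 : FreeAlgebra ℝ (Fin 2))] := by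
    ext1 i j
    fin_cases i <;> fin_cases j <;> simp [wildU, Matrix.mul_apply, Fin.sum_univ_succ]
  rw [this]
  ext1 i j
  fin_cases i <;> fin_cases j <;> simp [wildT, Matrix.mul_apply, Fin.sum_univ_succ]

theorem wildT_mul_sub_one : wildT * (wildT - 1) = !![0, 0, 0, 0, 0, 0; 1, 0, 0, 0, 0, 0;
    0, 0, 0, 0, 0, 0; ι ℝ 0, ι ℝ 0, 1, 0, 0, 0; ι ℝ 1, ι ℝ 1, 0, 0, 0, 0; 0, 0, 0, 0, 0, 0] := by
  have : wildT - 1 = !![0, 0, 0, 0, 0, 0; 1, 0, 0, 0, 0, 0;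
    0, 0, 0, 0, 0, 0; 0, ι ℝ 0, 1, 0, 0, 0; 0, ι ℝ 1, 0, 0, 0, 0; 0, 0, 0, 0, 0, -1] := by
    ext1 i j
    fin_cases i <;> fin_cases j <;> simp [wildT]
  rw [this]
  ext1 i j
  fin_cases i <;> fin_cases j <;> simp [wildT, Matrix.mul_apply, Fin.sum_univ_succ]

theorem wildT_mul_sub_one_mul_wildU : wildT * (wildT - 1) * wildU = Matrix.single 3 0 1 := by
  rw [wildT_mul_sub_one]
  ext1 i j
  fin_cases i <;> fin_cases j <;> simp [wildU, Matrix.mul_apply, Fin.sum_univ_succ]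

theorem wildT_mul_sub_one_sq : wildT * (wildT - 1) * (wildT - 1) =
    Matrix.single 3 0 (ι ℝ 0) + Matrix.single 4 0 (ι ℝ 1) := by
  rw [wildT_mul_sub_one, mul_sub, mul_one]
  ext1 i j
  fin_cases i <;> fin_cases j <;> simp [wildT]

/-- The first summand is 1 + (T - 1)³: it is 1 on the module, where x³ = 0, and 0 on the sixth
block, where T = 0. The cube of U is the complementary projection. -/
theorem wild_generate : wildT * (wildT * wildT - 3 • wildT + 3 • 1) +
    wildU * (wildU * wildU) = 1 := by
  have e : wildT * (wildT * wildT - 3 • wildT + 3 • 1) =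
      wildT * (wildT - 1) * (wildT - 1) - wildT * (wildT - 1) + wildT := by noncomm_ring
  rw [e, wildT_mul_sub_one_sq, wildT_mul_sub_one]
  have : wildU * (wildU * wildU) = Matrix.single 5 5 1 := by
    have : wildU * wildU = !![0, 0, 0, 0, 0, 0; 0, 0, 0, 0, 0, 0; 0, 0, 0, 0, 0, 0;
        0, 0, 0, 0, 0, 0; 1, 0, 0, 0, 0, 0; 0, 0, 0, 0, 0, (1 : FreeAlgebra ℝ (Fin 2))] := by
      ext1 i j
      fin_cases i <;> fin_cases j <;> simp [wildU, Matrix.mul_apply, Fin.sum_univ_succ]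
    rw [this]
    ext1 i j
    fin_cases i <;> fin_cases j <;> simp [wildU, Matrix.mul_apply, Fin.sum_univ_succ]
  rw [this]
  ext1 i j
  fin_cases i <;> fin_cases j <;> simp [wildT]

end WildTemplates

/-! ### Recovering the pair from the weak similarity class -/

section Rigidity

variable {m : ℕ}

theorem wildT_apply_of_lt {i j : Fin 6} (h : i < j) : wildT i j = 0 := by
  revert h
  fin_cases i <;> fin_cases j <;> simp [wildT]

theorem wildU_apply_of_lt {i j : Fin 6} (h : i < j) : wildU i j = 0 := by
  revert h
  fin_cases i <;> fin_cases j <;> simp [wildU]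

/-- The templates are lower triangular with scalar diagonals (1, 1, 1, 1, 1, 0) and (0, 0, 0, 0, 0,
1), so M and N do not enter the trace. -/
theorem trace_wild_pow (P : MatPair (Fin m)) (a b : ℝ) (k : ℕ) :
    ((a • wildT.subst P + b • wildU.subst P) ^ k).trace = (5 * a ^ k + b ^ k) * m := by
  rw [← Template.subst_smul, ← Template.subst_smul, ← Template.subst_add, ← Template.subst_pow,
    trace_subst]
  have hl : ∀ i j : Fin 6, i < j → (a • wildT + b • wildU) i j = 0 := fun i j h => by
    simp [wildT_apply_of_lt h, wildU_apply_of_lt h]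
  have hs : ∀ c : ℝ, ((c • (1 : Matrix (Fin m) (Fin m) ℝ)) ^ k).trace = c ^ k * m := fun c => by
    rw [smul_pow, one_pow, Matrix.trace_smul]
    simp
  simp only [(pow_apply_of_lowerTriangular hl k).2, Fin.sum_univ_succ, map_pow]
  simp [wildT, wildU, hs]
  ring

theorem eq_one_zero_of_power_sums {a b : ℝ} (h₁ : 5 * a + b = 5) (h₂ : 5 * a ^ 2 + b ^ 2 = 5)
    (h₃ : 5 * a ^ 3 + b ^ 3 = 5) : a = 1 ∧ b = 0 := by
  obtain rfl : b = 5 - 5 * a := by linarith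
  have : (a - 1) * (3 * a - 2) = 0 := by linarith
  rcases mul_eq_zero.1 this with h | h
  · obtain rfl : a = 1 := by linarith
    norm_num
  · obtain rfl : a = 2 / 3 := by linarith
    norm_num at h₃

theorem eq_zero_one_of_power_sums {a b : ℝ} (h₁ : 5 * a + b = 1) (h₂ : 5 * a ^ 2 + b ^ 2 = 1)
    (h₃ : 5 * a ^ 3 + b ^ 3 = 1) : a = 0 ∧ b = 1 := by
  obtain rfl : b = 1 - 5 * a := by linarith
  have : a * (3 * a - 1) = 0 := by linarith
  rcases mul_eq_zero.1 this with h | h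
  · subst h
    norm_num
  · obtain rfl : a = 1 / 3 := by linarith
    norm_num at h₃

theorem trace_pow_conj {n : Type} [Fintype n] [DecidableEq n] {X Y : Matrix n n ℝ} {S : GL n ℝ}
    (h : Y = (↑S⁻¹ : Matrix n n ℝ) * X * (S : Matrix n n ℝ)) (k : ℕ) :
    (Y ^ k).trace = (X ^ k).trace := by
  rw [h, Units.conj_pow', Matrix.trace_units_conj']

/-- Weak similarity of the images is similarity: the multiplicities `5m` and `m` of the joint
eigenvalues `(1, 0)` and `(0, 1)` rigidify the pair. -/
theorem similar_of_weaklySimilar_wild (hm : 1 ≤ m) {P P' : MatPair (Fin m)}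
    (h : WeaklySimilar (wildT.subst P, wildU.subst P) (wildT.subst P', wildU.subst P')) :
    Similar (wildT.subst P, wildU.subst P) (wildT.subst P', wildU.subst P') := by
  obtain ⟨S, g, h₁, h₂⟩ := h
  have hm' : (m : ℝ) ≠ 0 := by positivity
  have e₁ : ∀ k, 5 * g.1 0 0 ^ k + g.1 0 1 ^ k = 5 * 1 ^ k + 0 ^ k := fun k => by
    have := trace_pow_conj h₁ k
    rw [trace_wild_pow] at this
    -- The trace of the conjugate is computed by the same formula with coefficients (1, 0).
    have h' := trace_wild_pow P' 1 0 k
    rw [one_smul, zero_smul, add_zero] at h'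
    exact mul_right_cancel₀ hm' (this.symm.trans h')
  have e₂ : ∀ k, 5 * g.1 1 0 ^ k + g.1 1 1 ^ k = 5 * 0 ^ k + 1 ^ k := fun k => by
    have := trace_pow_conj h₂ k
    rw [trace_wild_pow] at this
    have h' := trace_wild_pow P' 0 1 k
    rw [one_smul, zero_smul, zero_add] at h'
    exact mul_right_cancel₀ hm' (this.symm.trans h')
  obtain ⟨ha, hb⟩ := eq_one_zero_of_power_sums (by simpa using e₁ 1) (by simpa using e₁ 2)
    (by simpa using e₁ 3)
  obtain ⟨hc, hd⟩ := eq_zero_one_of_power_sums (by simpa using e₂ 1) (by simpa using e₂ 2)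
    (by simpa using e₂ 3)
  refine ⟨S, ?_, ?_⟩
  · simpa [ha, hb] using h₁
  · simpa [hc, hd] using h₂

theorem apply_eq_of_commute_single {R : Type*} [Ring R] {σ : Matrix (Fin 6) (Fin 6) R} {k : Fin 6}
    (h : σ * Matrix.single k 0 1 = Matrix.single k 0 1 * σ) :
    σ k k = σ 0 0 ∧ (∀ i, i ≠ k → σ i k = 0) ∧ ∀ j, j ≠ 0 → σ 0 j = 0 := by
  refine ⟨?_, fun i hi => ?_, fun j hj => ?_⟩
  · simpa using congrFun (congrFun h k) 0
  · simpa [hi] using congrFun (congrFun h i) 0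
  · simpa [hj] using (congrFun (congrFun h k) j).symm

/-- Commuting with the two matrix units makes the diagonal blocks 0, 3, 4 of σ equal and kills the
mixed blocks between 3 and 4; entries (3, 0) and (4, 0) of `h` then separate. -/
theorem intertwine_of_single {R : Type*} [Ring R] {σ : Matrix (Fin 6) (Fin 6) R} {M N M' N' : R}
    (h₃ : σ * Matrix.single 3 0 1 = Matrix.single 3 0 1 * σ)
    (h₄ : σ * Matrix.single 4 0 1 = Matrix.single 4 0 1 * σ)
    (h : σ * (Matrix.single 3 0 M' + Matrix.single 4 0 N') =
      (Matrix.single 3 0 M + Matrix.single 4 0 N) * σ) :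
    σ 0 0 * M' = M * σ 0 0 ∧ σ 0 0 * N' = N * σ 0 0 := by
  obtain ⟨a₃, b₃, -⟩ := apply_eq_of_commute_single h₃
  obtain ⟨a₄, b₄, -⟩ := apply_eq_of_commute_single h₄
  rw [mul_add, add_mul] at h
  constructor
  · simpa [a₃, b₄] using congrFun (congrFun h 3) 0
  · simpa [a₄, b₃] using congrFun (congrFun h 4) 0

/-- The matrix of blocks of a matrix. -/
def blocks (d m : ℕ) : Matrix (Fin d × Fin m) (Fin d × Fin m) ℝ ≃+*
    Matrix (Fin d) (Fin d) (Matrix (Fin m) (Fin m) ℝ) :=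
  (Matrix.compRingEquiv (Fin d) (Fin m) ℝ).symm

theorem similar_of_similar_wild {P P' : MatPair (Fin m)}
    (h : Similar (wildT.subst P, wildU.subst P) (wildT.subst P', wildU.subst P')) :
    Similar P P' := by
  obtain ⟨S, h₁, h₂⟩ := h
  let φ (P : MatPair (Fin m)) : Template 6 →+* Matrix (Fin 6) (Fin 6) (Matrix (Fin m) (Fin m) ℝ) :=
    RingHom.mapMatrix (FreeAlgebra.lift ℝ ![P.1, P.2]).toRingHom
  let σ : (Matrix (Fin 6) (Fin 6) (Matrix (Fin m) (Fin m) ℝ))ˣ :=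
    Units.map (blocks 6 m).toRingHom.toMonoidHom S
  have hT : φ P' wildT = σ⁻¹.1 * φ P wildT * σ.1 := by
    have := congrArg (blocks 6 m) h₁
    rwa [map_mul, map_mul] at this
  have hU : φ P' wildU = σ⁻¹.1 * φ P wildU * σ.1 := by
    have := congrArg (blocks 6 m) h₂
    rwa [map_mul, map_mul] at this
  have cT : SemiconjBy σ.1 (φ P' wildT) (φ P wildT) := by
    rw [SemiconjBy, hT, mul_assoc, Units.mul_inv_cancel_left]
  have cU : SemiconjBy σ.1 (φ P' wildU) (φ P wildU) := by
    rw [SemiconjBy, hU, mul_assoc, Units.mul_inv_cancel_left]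
  have cT' : SemiconjBy σ.1 (φ P' (wildT - 1)) (φ P (wildT - 1)) := by
    rw [map_sub, map_sub, map_one, map_one]
    exact cT.sub_right (SemiconjBy.one_right _)
  have φs : ∀ (P : MatPair (Fin m)) (i j : Fin 6) (a), φ P (Matrix.single i j a) =
      Matrix.single i j (FreeAlgebra.lift ℝ ![P.1, P.2] a) := fun P i j a => by
    simp [φ, Matrix.map_single]
  have c₄ : SemiconjBy σ.1
      (Matrix.single 4 0 1) (Matrix.single 4 0 1) := by
    have := cT.mul_right (cU.mul_right cU)
    simpa only [← map_mul, wildT_mul_wildU_sq, φs, map_one] using this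
  have c₃ : SemiconjBy σ.1
      (Matrix.single 3 0 1) (Matrix.single 3 0 1) := by
    have := (cT.mul_right cT').mul_right cU
    simpa only [← map_mul, wildT_mul_sub_one_mul_wildU, φs, map_one] using this
  have c₅ : SemiconjBy σ.1
      (Matrix.single 3 0 P'.1 + Matrix.single 4 0 P'.2)
      (Matrix.single 3 0 P.1 + Matrix.single 4 0 P.2) := by
    have := (cT.mul_right cT').mul_right cT'
    rw [← map_mul, ← map_mul, ← map_mul, ← map_mul, wildT_mul_sub_one_sq] at this
    simpa [φs] using this
  obtain ⟨hM, hN⟩ := intertwine_of_single c₃ c₄ c₅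
  have hrow := (apply_eq_of_commute_single c₄).2.2
  -- Row 0 of σ is zero off the diagonal, so the (0, 0) block of σσ⁻¹ = 1 is a single product; a
  -- one-sided inverse of a square real matrix is two-sided.
  have e : σ.1 0 0 *
      σ⁻¹.1 0 0 = 1 := by
    have := congrFun (congrFun σ.mul_inv 0) 0
    rw [Matrix.mul_apply, Finset.sum_eq_single 0 (fun j _ hj => by rw [hrow j hj, zero_mul])
      (by simp)] at this
    simpa using this
  let s : GL (Fin m) ℝ := ⟨_, _, e, mul_eq_one_comm.1 e⟩
  refine ⟨s, ?_, ?_⟩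
  · rw [mul_assoc]
    exact (Units.inv_mul_eq_iff_eq_mul s).2 hM.symm |>.symm
  · rw [mul_assoc]
    exact (Units.inv_mul_eq_iff_eq_mul s).2 hN.symm |>.symm

theorem similar_iff_weaklySimilar_wild (hm : 1 ≤ m) {P P' : MatPair (Fin m)} :
    Similar P P' ↔
      WeaklySimilar (wildT.subst P, wildU.subst P) (wildT.subst P', wildU.subst P') :=
  ⟨weaklySimilar_subst_of_similar _ _,
    fun h => similar_of_similar_wild (similar_of_weaklySimilar_wild hm h)⟩

end Rigidity

/-! ### Commutation, joint surjectivity and independence after substitution -/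

section WildProperties

variable {m : ℕ}

theorem wild_subst_commute (P : MatPair (Fin m)) : Commute (wildT.subst P) (wildU.subst P) :=
  (show Commute wildT wildU from wild_commute).map (substHom 6 P)

theorem wild_jointlySurjective (P : MatPair (Fin m)) :
    JointlySurjective (wildT.subst P, wildU.subst P) := by
  rw [JointlySurjective, eq_top_iff]
  intro x _
  have := congrArg (substHom 6 P) wild_generate
  rw [map_add, map_mul _ wildT, map_mul _ wildU, map_one] at this
  rw [← Matrix.one_mulVec x, ← this, Matrix.add_mulVec, ← Matrix.mulVec_mulVec,
    ← Matrix.mulVec_mulVec]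
  exact add_mem (Submodule.mem_sup_left ⟨_, rfl⟩) (Submodule.mem_sup_right ⟨_, rfl⟩)

theorem wild_linearIndependent (hm : 1 ≤ m) (P : MatPair (Fin m)) :
    LinearIndependent ℝ ![wildT.subst P, wildU.subst P] := by
  rw [LinearIndependent.pair_iff]
  intro a b hab
  -- Diagonal entries in blocks 0 and 5, where (T, U) has the values (1, 0) and (0, 1).
  have ha := congrFun (congrFun hab (0, ⟨0, hm⟩)) (0, ⟨0, hm⟩)
  have hb := congrFun (congrFun hab (5, ⟨0, hm⟩)) (5, ⟨0, hm⟩)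
  simp [Template.subst, wildT, wildU] at ha hb
  exact ⟨ha, hb⟩

end WildProperties

/-! ### Containment of problems -/

section Containment

theorem eval_bind₁ {σ τ : Type} (f : σ → MvPolynomial τ ℝ) (a : τ → ℝ) (p : MvPolynomial σ ℝ) :
    MvPolynomial.eval a (MvPolynomial.bind₁ f p) =
      MvPolynomial.eval (fun j => MvPolynomial.eval a (f j)) p :=
  MvPolynomial.eval₂Hom_bind₁ (RingHom.id ℝ) a f p

theorem ClassificationProblem.Contains.trans {P Q R : ClassificationProblem} (hPQ : P.Contains Q)
    (hQR : Q.Contains R) : P.Contains R := by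
  obtain ⟨N, hN, F, hF⟩ := hPQ
  obtain ⟨N', hN', F', hF'⟩ := hQR
  refine ⟨fun n => N (N' n), hN.comp hN', fun n i => MvPolynomial.bind₁ (F' n) (F (N' n) i),
    fun n => ?_⟩
  simp only [eval_bind₁]
  exact ⟨fun a ha => (hF _).1 _ ((hF' n).1 a ha), fun a b ha hb => ((hF' n).2 a b ha hb).trans
    ((hF _).2 _ _ ((hF' n).1 a ha) ((hF' n).1 b hb))⟩

/-- The equivalence relation of `lieProblem` does not depend on the class, so only membership has to
be enlarged. -/
theorem lieProblem_contains_mono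
    {C C' : ℕ → ∀ (L : Type) [LieRing L] [LieAlgebra ℝ L], Prop}
    (hC : ∀ (n : ℕ) (L : Type) [LieRing L] [LieAlgebra ℝ L], C n L → C' n L)
    {Q : ClassificationProblem} (h : (lieProblem C).Contains Q) : (lieProblem C').Contains Q := by
  obtain ⟨N, hN, F, hF⟩ := h
  refine ⟨N, hN, F, fun n => ⟨fun a ha => ?_, (hF n).2⟩⟩
  obtain ⟨L, i, j, hL, hc⟩ := (hF n).1 a ha
  exact ⟨L, i, j, hC _ L hL, hc⟩

end Containment

/-! ### Change of index set -/

section Reindex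

variable {ι κ : Type} [Fintype ι] [DecidableEq ι] [Fintype κ] [DecidableEq κ]

/-- Transport a pair of matrices along a bijection of the index sets. -/
def MatPair.reindex (e : ι ≃ κ) (P : MatPair ι) : MatPair κ :=
  (Matrix.reindexAlgEquiv ℝ ℝ e P.1, Matrix.reindexAlgEquiv ℝ ℝ e P.2)

theorem WeaklySimilar.reindex {P P' : MatPair ι} (h : WeaklySimilar P P') (e : ι ≃ κ) :
    WeaklySimilar (P.reindex e) (P'.reindex e) := by
  obtain ⟨S, g, h₁, h₂⟩ := h
  refine ⟨Units.map (Matrix.reindexAlgEquiv ℝ ℝ e).toRingEquiv.toMonoidHom S, g, ?_, ?_⟩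
  · change _ = Matrix.reindexAlgEquiv ℝ ℝ e S⁻¹.1 * _ * Matrix.reindexAlgEquiv ℝ ℝ e S.1
    simp only [MatPair.reindex, h₁, map_mul, map_add, map_smul]
  · change _ = Matrix.reindexAlgEquiv ℝ ℝ e S⁻¹.1 * _ * Matrix.reindexAlgEquiv ℝ ℝ e S.1
    simp only [MatPair.reindex, h₂, map_mul, map_add, map_smul]

theorem MatPair.reindex_symm_reindex (e : ι ≃ κ) (P : MatPair ι) :
    (P.reindex e).reindex e.symm = P := by
  simp [MatPair.reindex]

theorem weaklySimilar_reindex_iff {P P' : MatPair ι} (e : ι ≃ κ) :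
    WeaklySimilar (P.reindex e) (P'.reindex e) ↔ WeaklySimilar P P' :=
  ⟨fun h => by simpa only [MatPair.reindex_symm_reindex] using h.reindex e.symm,
    fun h => h.reindex e⟩

theorem JointlySurjective.reindex {P : MatPair ι} (h : JointlySurjective P) (e : ι ≃ κ) :
    JointlySurjective (P.reindex e) := by
  rw [jointlySurjective_iff] at h ⊢
  intro x
  obtain ⟨a, b, hab⟩ := h (x ∘ e)
  refine ⟨a ∘ e.symm, b ∘ e.symm, ?_⟩
  simp only [MatPair.reindex, Matrix.coe_reindexAlgEquiv, Matrix.reindex_apply,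
    Matrix.submatrix_mulVec_equiv, Equiv.symm_symm, Function.comp_assoc, Equiv.symm_comp_self,
    Function.comp_id]
  funext i
  simpa using congrFun hab (e.symm i)

end Reindex

/-! ### Wildness for matrix pairs -/

section PairWildness

/-- The matrix of independent variables. -/
def genericMatrix (n : ℕ) (k : Fin 2) :
    Matrix (Fin n) (Fin n) (MvPolynomial (Fin 2 × Fin n × Fin n) ℝ) :=
  Matrix.of fun i j => MvPolynomial.X (k, i, j)

/-- Both sides are algebra homomorphisms in p that agree on the two generators. This makes template
substitution polynomial in the entries. -/
theorem eval_lift_genericMatrix {n : ℕ} (a : Fin 2 × Fin n × Fin n → ℝ)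
    (p : FreeAlgebra ℝ (Fin 2)) (i j : Fin n) :
    MvPolynomial.eval a (FreeAlgebra.lift ℝ ![genericMatrix n 0, genericMatrix n 1] p i j) =
      FreeAlgebra.lift ℝ ![(pairOfCoord a).1, (pairOfCoord a).2] p i j := by
  let φ : FreeAlgebra ℝ (Fin 2) →ₐ[ℝ] Matrix (Fin n) (Fin n) ℝ :=
    (MvPolynomial.aeval a : MvPolynomial (Fin 2 × Fin n × Fin n) ℝ →ₐ[ℝ] ℝ).mapMatrix.comp
      (FreeAlgebra.lift ℝ ![genericMatrix n 0, genericMatrix n 1])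
  have : φ = FreeAlgebra.lift ℝ ![(pairOfCoord a).1, (pairOfCoord a).2] := by
    refine FreeAlgebra.hom_ext (funext fun k => ?_)
    ext i j
    fin_cases k <;> simp [φ, genericMatrix, pairOfCoord]
  rw [← this]
  simp [φ]

/-- The entries of a pair of templates, as polynomials in the entries of the matrices substituted
for the variables. -/
def templatePolynomial {d : ℕ} (T U : Template d) (n : ℕ)
    (c : Fin 2 × Fin (d * n) × Fin (d * n)) : MvPolynomial (Fin 2 × Fin n × Fin n) ℝ :=
  let i := finProdFinEquiv.symm c.2.1
  let j := finProdFinEquiv.symm c.2.2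
  FreeAlgebra.lift ℝ ![genericMatrix n 0, genericMatrix n 1] (![T, U] c.1 i.1 j.1) i.2 j.2

theorem pairOfCoord_templatePolynomial {d n : ℕ} (T U : Template d)
    (a : Fin 2 × Fin n × Fin n → ℝ) :
    pairOfCoord (fun c => MvPolynomial.eval a (templatePolynomial T U n c)) =
      MatPair.reindex finProdFinEquiv (T.subst (pairOfCoord a), U.subst (pairOfCoord a)) := by
  refine Prod.ext ?_ ?_ <;> ext i j <;>
  simp [pairOfCoord, templatePolynomial, eval_lift_genericMatrix, MatPair.reindex, Template.subst]

theorem surjectiveCommutingPairs_isWild : surjectiveCommutingPairsUpToWeakSimilarity.IsWild := by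
  refine ⟨fun n => 6 * n, fun n n' h => by simpa using h,
    fun n => templatePolynomial wildT wildU n, fun n =>
      ⟨fun (a : Fin 2 × Fin n × Fin n → ℝ) (ha : 1 ≤ n) => ?_,
        fun (a b : Fin 2 × Fin n × Fin n → ℝ) (ha : 1 ≤ n) _ => ?_⟩⟩
  · refine ⟨show 2 ≤ 6 * n by omega, ?_⟩
    change Commute (pairOfCoord fun c => MvPolynomial.eval a (templatePolynomial wildT wildU n c)).1
        (pairOfCoord fun c => MvPolynomial.eval a (templatePolynomial wildT wildU n c)).2 ∧
      JointlySurjective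
        (pairOfCoord fun c => MvPolynomial.eval a (templatePolynomial wildT wildU n c))
    rw [pairOfCoord_templatePolynomial]
    exact ⟨(wild_subst_commute _).map (Matrix.reindexAlgEquiv ℝ ℝ finProdFinEquiv),
      (wild_jointlySurjective _).reindex _⟩
  · change Similar (pairOfCoord a) (pairOfCoord b) ↔ WeaklySimilar
      (pairOfCoord fun c => MvPolynomial.eval a (templatePolynomial wildT wildU n c))
      (pairOfCoord fun c => MvPolynomial.eval b (templatePolynomial wildT wildU n c))
    rw [pairOfCoord_templatePolynomial, pairOfCoord_templatePolynomial, weaklySimilar_reindex_iff]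
    exact similar_iff_weaklySimilar_wild ha

theorem commutingPairs_isWild : commutingPairsUpToWeakSimilarity.IsWild := by
  obtain ⟨N, hN, F, hF⟩ := surjectiveCommutingPairs_isWild
  refine ⟨N, hN, F, fun n => ⟨fun a ha => ?_, (hF n).2⟩⟩
  obtain ⟨h₁, h₂, -⟩ := (hF n).1 a ha
  exact ⟨one_le_two.trans h₁, h₂⟩

end PairWildness

/-! ### Wildness for Lie algebras given by structure constants -/

section StructureConstants

/-- Makes the relation of `lieProblem`, which asks only for some algebras with the given constants,
independent of which ones are chosen. -/
theorem HasStructureConstants.nonempty_lieEquiv {k : ℕ} {c : Fin k × Fin k × Fin k → ℝ}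
    {L L' : Type} [LieRing L] [LieAlgebra ℝ L] [LieRing L'] [LieAlgebra ℝ L']
    (h : HasStructureConstants c L) (h' : HasStructureConstants c L') :
    Nonempty (L ≃ₗ⁅ℝ⁆ L') := by
  obtain ⟨b, hb⟩ := h
  obtain ⟨b', hb'⟩ := h'
  let φ := b.equiv b' (Equiv.refl _)
  have hφ : ∀ i, φ (b i) = b' i := fun i => by simp [φ]
  refine ⟨{ φ with map_lie' := ?_ }⟩
  intro u v
  change φ ⁅u, v⁆ = ⁅φ u, φ v⁆
  rw [← b.sum_repr u, ← b.sum_repr v]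
  simp only [map_sum, map_smul, sum_lie, lie_sum, smul_lie, lie_smul, hφ, hb, hb']

variable {n : ℕ}

/-- The structure constants of the algebra of a generic pair of matrices. -/
def extPolynomial (n : ℕ) : Fin n ⊕ Fin 2 → Fin n ⊕ Fin 2 → Fin n ⊕ Fin 2 →
    MvPolynomial (Fin 2 × Fin n × Fin n) ℝ
  | .inr k, .inl j, .inl l => MvPolynomial.X (k, l, j)
  | .inl j, .inr k, .inl l => -MvPolynomial.X (k, l, j)
  | _, _, _ => 0

/-- The basis of the algebra of a pair of matrices adapted to its decomposition. -/
def Ext.basis (A B : Matrix (Fin n) (Fin n) ℝ) (h : Commute A B) :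
    Module.Basis (Fin n ⊕ Fin 2) ℝ (Ext A B h) :=
  ((Pi.basisFun ℝ (Fin n)).prod (Module.Basis.finTwoProd ℝ)).map (Ext.toProd A B h).symm

section Basis

variable {A B : Matrix (Fin n) (Fin n) ℝ} {h : Commute A B}

theorem Ext.basis_inl (i : Fin n) :
    Ext.basis A B h (.inl i) = Ext.mk A B h (Pi.single i 1) 0 0 := by
  rw [← (Ext.toProd A B h).injective.eq_iff, Ext.toProd_mk]
  simp [Ext.basis, Module.Basis.prod_apply, Prod.ext_iff]

theorem Ext.basis_inr (k : Fin 2) :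
    Ext.basis A B h (.inr k) = Ext.mk A B h 0 (![1, 0] k) (![0, 1] k) := by
  rw [← (Ext.toProd A B h).injective.eq_iff, Ext.toProd_mk]
  fin_cases k <;> simp [Ext.basis, Module.Basis.prod_apply]

theorem Ext.sum_smul_basis_inl (x : Fin n → ℝ) :
    ∑ l, x l • Ext.basis A B h (.inl l) = Ext.mk A B h x 0 0 := by
  simp only [Ext.basis_inl]
  simp only [← Ext.inclusion_apply, ← map_smul, ← map_sum]
  congr 1
  ext i
  simp [Pi.single_apply]

end Basis

theorem hasStructureConstants_ext (a : Fin 2 × Fin n × Fin n → ℝ)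
    (h : Commute (pairOfCoord a).1 (pairOfCoord a).2) :
    HasStructureConstants (fun c : Fin (n + 2) × Fin (n + 2) × Fin (n + 2) =>
      MvPolynomial.eval a (extPolynomial n (finSumFinEquiv.symm c.1) (finSumFinEquiv.symm c.2.1)
        (finSumFinEquiv.symm c.2.2))) (Ext _ _ h) := by
  refine ⟨(Ext.basis _ _ h).reindex finSumFinEquiv, fun i j => ?_⟩
  simp only [Module.Basis.reindex_apply]
  rw [finSumFinEquiv.symm.sum_comp (fun r => MvPolynomial.eval a (extPolynomial n
    (finSumFinEquiv.symm i) (finSumFinEquiv.symm j) r) • Ext.basis _ _ h r)]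
  generalize finSumFinEquiv.symm i = p
  generalize finSumFinEquiv.symm j = q
  have h0 : ∀ x, x = 0 → Ext.mk _ _ h x 0 0 = 0 := fun x hx => by rw [hx]; rfl
  rw [Fintype.sum_sum_type]
  rcases p with p | p <;> rcases q with q | q
  · simp only [extPolynomial, Ext.basis_inl, Ext.lie_mk, map_zero, zero_smul, sub_self, add_zero,
      Finset.sum_const_zero]
    rfl
  · simp only [extPolynomial, map_neg, MvPolynomial.eval_X, map_zero, zero_smul,
      Finset.sum_const_zero, add_zero]
    rw [Ext.sum_smul_basis_inl (fun l => -a (q, l, p)), Ext.basis_inl, Ext.basis_inr, Ext.lie_mk,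
      Ext.mk_inj]
    refine ⟨?_, rfl, rfl⟩
    ext l
    fin_cases q <;> simp [pairOfCoord]
  · simp only [extPolynomial, MvPolynomial.eval_X, map_zero, zero_smul,
      Finset.sum_const_zero, add_zero]
    rw [Ext.sum_smul_basis_inl (fun l => a (p, l, q)), Ext.basis_inl, Ext.basis_inr, Ext.lie_mk,
      Ext.mk_inj]
    refine ⟨?_, rfl, rfl⟩
    ext l
    fin_cases p <;> simp [pairOfCoord]
  · simp only [extPolynomial, Ext.basis_inr, Ext.lie_mk, map_zero, zero_smul, Matrix.mulVec_zero,
      smul_zero, sub_self, add_zero, Finset.sum_const_zero]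
    rfl

theorem lieProblem_isLieCZ_contains :
    (lieProblem IsLieCZ).Contains surjectiveCommutingPairsUpToWeakSimilarity := by
  -- Sizes are unchanged because `lieProblem` indexes algebras of dimension n + 2 by n.
  refine ⟨id, Function.injective_id, fun n c => extPolynomial n (finSumFinEquiv.symm c.1)
    (finSumFinEquiv.symm c.2.1) (finSumFinEquiv.symm c.2.2), fun n => ⟨?_, ?_⟩⟩
  · rintro a ⟨hn, hc, hs⟩
    refine ⟨Ext _ _ hc, inferInstance, inferInstance, ?_, hasStructureConstants_ext a hc⟩
    simpa using Ext.isLieCZ (h := hc) (by simpa using hn) hs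
  · rintro a b ⟨-, hc, hs⟩ ⟨-, hc', hs'⟩
    refine (Ext.nonempty_lieEquiv_iff (h := hc) (h' := hc') hs hs').symm.trans ⟨fun hw => ?_, ?_⟩
    · exact ⟨Ext _ _ hc, inferInstance, inferInstance, Ext _ _ hc', inferInstance, inferInstance,
        hasStructureConstants_ext a hc, hasStructureConstants_ext b hc', hw⟩
    · rintro ⟨L, _, _, L', _, _, hL, hL', ⟨φ⟩⟩
      obtain ⟨φ₁⟩ := (hasStructureConstants_ext a hc).nonempty_lieEquiv hL
      obtain ⟨φ₂⟩ := hL'.nonempty_lieEquiv (hasStructureConstants_ext b hc')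
      exact ⟨(φ₁.trans φ).trans φ₂⟩

theorem lieProblem_isLieCZ_isWild : (lieProblem IsLieCZ).IsWild :=
  lieProblem_isLieCZ_contains.trans surjectiveCommutingPairs_isWild

end StructureConstants

end WildLie

end

open WildLie in
theorem theorem2 :
    -- the algebra of a jointly surjective commuting pair has abelian derived algebra, `[z, y] = 0`
    (∀ (n : ℕ) (_ : 2 ≤ n) (A B : Matrix (Fin n) (Fin n) ℝ) (h : Commute A B),
      JointlySurjective (A, B) → IsLieCZ n (Ext A B h)) ∧
    -- all Lie algebras of that subclass arise in this way
    (∀ (n : ℕ) (L : Type) [LieRing L] [LieAlgebra ℝ L], IsLieCZ n L →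
      ∃ (A B : Matrix (Fin n) (Fin n) ℝ) (h : Commute A B),
        JointlySurjective (A, B) ∧ Nonempty (L ≃ₗ⁅ℝ⁆ Ext A B h)) ∧
    -- isomorphism is weak similarity
    (∀ (n : ℕ) (_ : 2 ≤ n) (A B A' B' : Matrix (Fin n) (Fin n) ℝ)
      (h : Commute A B) (h' : Commute A' B'),
      JointlySurjective (A, B) → JointlySurjective (A', B') →
      (Nonempty (Ext A B h ≃ₗ⁅ℝ⁆ Ext A' B' h') ↔ WeaklySimilar (A, B) (A', B'))) ∧
    (lieProblem IsLieCZ).Contains surjectiveCommutingPairsUpToWeakSimilarity ∧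
    -- classifying commuting pairs up to weak similarity is wild
    commutingPairsUpToWeakSimilarity.IsWild ∧
    surjectiveCommutingPairsUpToWeakSimilarity.IsWild ∧
    -- classifying the Lie algebras is wild
    (lieProblem IsLie).IsWild ∧ (lieProblem IsLieC).IsWild ∧ (lieProblem IsLieCZ).IsWild ∧
    -- wildness is realized by one pair of block matrices over the free algebra, for all sizes
    (∃ (d : ℕ) (T U : Template d), ∀ m : ℕ, 1 ≤ m →
      ∃ h : ∀ P : MatPair (Fin m), Commute (T.subst P) (U.subst P),
        (∀ P : MatPair (Fin m),
          JointlySurjective (T.subst P, U.subst P) ∧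
          LinearIndependent ℝ ![T.subst P, U.subst P] ∧
          IsLieCZ (d * m) (Ext (T.subst P) (U.subst P) (h P))) ∧
        ∀ P P' : MatPair (Fin m),
          (Similar P P' ↔
            WeaklySimilar (T.subst P, U.subst P) (T.subst P', U.subst P')) ∧
          (Similar P P' ↔
            Nonempty (Ext (T.subst P) (U.subst P) (h P) ≃ₗ⁅ℝ⁆
              Ext (T.subst P') (U.subst P') (h P')))) := by
  refine ⟨fun n hn A B h hs => ?_, fun n L _ _ hL => exists_lieEquiv_ext hL,
    fun n _ A B A' B' h h' hs hs' => Ext.nonempty_lieEquiv_iff hs hs',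
    lieProblem_isLieCZ_contains, commutingPairs_isWild, surjectiveCommutingPairs_isWild,
    lieProblem_contains_mono (fun _ _ _ _ hL => hL.1.1) lieProblem_isLieCZ_isWild,
    lieProblem_contains_mono (fun _ _ _ _ hL => hL.1) lieProblem_isLieCZ_isWild,
    lieProblem_isLieCZ_isWild, 6, wildT, wildU, fun m hm => ⟨wild_subst_commute, fun P => ⟨
      wild_jointlySurjective P, wild_linearIndependent hm P, ?_⟩, fun P P' => ⟨
      similar_iff_weaklySimilar_wild hm, (similar_iff_weaklySimilar_wild hm).trans
        (Ext.nonempty_lieEquiv_iff (wild_jointlySurjective P) (wild_jointlySurjective P')).symm⟩⟩⟩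
  · simpa using Ext.isLieCZ (h := h) (by simpa using hn) hs
  · have hcard : Fintype.card (Fin 6 × Fin m) = 6 * m := by simp
    rw [← hcard]
    exact Ext.isLieCZ (by omega) (wild_jointlySurjective P)
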